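/- Let $V=\coprod_{n\in\mathbb Z}V_{(n)}$ be a vertex operator algebra over $\mathbb C$ (with $\dim V_{(n)}<\infty$ and $V_{(n)}=0$ for $n$ sufficiently small). A $V$-module is a $\mathbb C$-graded space $W=\coprod_{n\in\mathbb C}W_{(n)}$, graded by the eigenvalues of $L(0)$, with $\dim W_{(n)}<\infty$ for all $n$ and $W_{(n)}=0$ for $n$ whose real part is sufficiently small, together with vertex operators $Y(v,x)=\sum_{n\in\mathbb Z}v_nx^{-n-1}$ on $W$, $v\in V$, satisfying all the axioms of a vertex operator algebra that make sense. Let $\overline W=\prod_{n\in\mathbb C}W_{(n)}$, let $P_n:\overline W\to W_{(n)}$ be the projections, let $W'=\coprod_{n\in\mathbb C}W_{(n)}^*$, and let $\langle\cdot,\cdot\rangle_W$ be the natural pairing between $W'$ and $\overline W$. For a nonzero complex number $z$ and $V$-modules $W_1,W_2,W_3$, a $P(z)$-intertwining map of type $\binom{W_3}{W_1W_2}$ is a linear map $F:W_1\otimes W_2\to\overline W_3$ such that, for all $v\in V$, $w_{(1)}\in W_1$, $w_{(2)}\in W_2$, $$x_0^{-1}\delta\Bigl(\frac{x_1-z}{x_0}\Bigr)Y_3(v,x_1)F(w_{(1)}\otimes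 w_{(2)})=z^{-1}\delta\Bigl(\frac{x_1-x_0}{z}\Bigr)F(Y_1(v,x_0)w_{(1)}\otimes w_{(2)})+x_0^{-1}\delta\Bigl(\frac{z-x_1}{-x_0}\Bigr)F(w_{(1)}\otimes Y_2(v,x_1)w_{(2)}),$$ where $\delta(x)=\sum_{n\in\mathbb Z}x^n$ and powers of a binomial are expanded in nonnegative integral powers of its second term. Given maps $F_1:W_1\otimes W_5\to\overline W_4$ and $F_2:W_2\otimes W_3\to\overline W_5$, the product of $F_1$ and $F_2$ exists if for all $w_{(i)}\in W_i$ $(i=1,2,3)$ and $w'_{(4)}\in W_4'$ the series $$\sum_{n\in\mathbb C}\langle w'_{(4)},F_1(w_{(1)}\otimes P_n(F_2(w_{(2)}\otimes w_{(3)})))\rangle_{W_4}$$ is absolutely convergent. Given maps $F_3:W_1\otimes W_2\to\overline W_5$ and $F_4:W_5\otimes W_3\to\overline W_4$, the iterate of $F_3$ and $F_4$ exists if for all $w_{(i)}\in W_i$ $(i=1,2,3)$ and $w'_{(4)}\in W_4'$ the series $$\sum_{n\in\mathbb C}\langle w'_{(4)},F_4(P_n(F_3(w_{(1)}\otimes w_{(2)}))\otimes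 w_{(3)})\rangle_{W_4}$$ is absolutely convergent. Proposition 14.1. For any vertex operator algebra $V$, the following two properties are equivalent: 1. For any $V$-modules $W_1,W_2,W_3,W_4,W_5$, any complex numbers $z_1,z_2$ satisfying $|z_1|>|z_2|>0$, any $P(z_1)$-intertwining map $F_1$ of type $\binom{W_4}{W_1W_5}$ and any $P(z_2)$-intertwining map $F_2$ of type $\binom{W_5}{W_2W_3}$, the product of $F_1$ and $F_2$ exists. 2. For any $V$-modules $W_1,W_2,W_3,W_4,W_5$, any complex numbers $z_3,z_4$ satisfying $|z_4|>|z_3|>0$, any $P(z_3)$-intertwining map $F_3$ of type $\binom{W_5}{W_1W_2}$ and any $P(z_4)$-intertwining map $F_4$ of type $\binom{W_4}{W_5W_3}$, the iterate of $F_3$ and $F_4$ exists. -/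

import Mathlib

open scoped TensorProduct

universe u w

noncomputable section

namespace VOA

/-- The operator `aₙ` on `W`, where `Y(a, x) = ∑_{n ∈ ℤ} aₙ x^(-n-1)`. -/
abbrev mode {V : Type*} [AddCommGroup V] [Module ℂ V] {W : Type*} [AddCommGroup W] [Module ℂ W]
    (Y : V →ₗ[ℂ] VertexOperator ℂ W) (a : V) (n : ℤ) : Module.End ℂ W :=
  VertexOperator.ncoeff (Y a) n

/-- The Jacobi identity for vertex operators `Y` on `V` and `YW` of `V` on `W` :
`x₀⁻¹ δ((x₁ - x₂)/x₀) YW(a, x₁) YW(b, x₂) - x₀⁻¹ δ((x₂ - x₁)/(-x₀)) YW(b, x₂) YW(a, x₁)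
  = x₂⁻¹ δ((x₁ - x₀)/x₂) YW(Y(a, x₀) b, x₂)`,
where `δ(x) = ∑_{n ∈ ℤ} xⁿ` and powers of binomials are expanded in nonnegative integral powers of
the second variable. Stated here is the equality of the coefficients of
`x₀^(-l-1) x₁^(-m-1) x₂^(-n-1)` applied to an arbitrary vector, for all integers `l`, `m`, `n`.
By lower truncation, only finitely many terms of each sum are nonzero. -/
def JacobiIdentity {V : Type*} [AddCommGroup V] [Module ℂ V] {W : Type*} [AddCommGroup W]
    [Module ℂ W] (Y : V →ₗ[ℂ] VertexOperator ℂ V) (YW : V →ₗ[ℂ] VertexOperator ℂ W) : Prop :=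
  ∀ (a b : V) (x : W) (l m n : ℤ),
    ∑ᶠ i : ℕ, ((-1 : ℂ) ^ i * (Ring.choose l i : ℤ)) •
        (mode YW a (m + l - i) (mode YW b (n + i) x))
      - ∑ᶠ i : ℕ, ((-1 : ℂ) ^ (l + i) * (Ring.choose l i : ℤ)) •
        (mode YW b (n + l - i) (mode YW a (m + i) x))
      = ∑ᶠ i : ℕ, ((Ring.choose m i : ℤ) : ℂ) •
        (mode YW (mode Y a (l + i) b) (m + n - i) x)

/-- The Virasoro relations
`[L(m), L(n)] = (m - n) L(m + n) + (1/12) (m³ - m) δ_{m+n,0} c` with central charge `c`. -/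
def VirasoroRelations {W : Type*} [AddCommGroup W] [Module ℂ W]
    (L : ℤ → Module.End ℂ W) (c : ℂ) : Prop :=
  ∀ m n : ℤ, L m * L n - L n * L m =
    ((m : ℂ) - n) • L (m + n) +
      if m + n = 0 then ((((m : ℂ) ^ 3 - m) / 12) * c) • (1 : Module.End ℂ W) else 0

end VOA

/-- A vertex operator algebra `(V, Y, 𝟏, ω)` over `ℂ`. The vertex operator map is
`Y(a, x) = ∑ₙ aₙ x^(-n-1)`, with `aₙ = VOA.mode Y a n`; that `aₙ b = 0` for `n` sufficiently large
is part of the type `VertexOperator ℂ V`. -/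
structure VertexOperatorAlgebra (V : Type u) [AddCommGroup V] [Module ℂ V] where
  /-- The homogeneous subspaces `V_(n)`, `n ∈ ℤ`. -/
  grading : ℤ → Submodule ℂ V
  isInternal : DirectSum.IsInternal grading
  finiteDimensional : ∀ n, FiniteDimensional ℂ (grading n)
  lower_truncated : ∃ N : ℤ, ∀ n < N, grading n = ⊥
  /-- The vertex operator map `a ↦ Y(a, x)`. -/
  Y : V →ₗ[ℂ] VertexOperator ℂ V
  /-- The vacuum vector `𝟏`. -/
  vacuum : V
  /-- The conformal (Virasoro) element `ω`. -/
  conformal : V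
  /-- The central charge (rank). -/
  rank : ℂ
  vacuum_mem : vacuum ∈ grading 0
  conformal_mem : conformal ∈ grading 2
  /-- `Y(𝟏, x) = 1`. -/
  vacuum_left : ∀ (n : ℤ) (a : V), VOA.mode Y vacuum n a = if n = -1 then a else 0
  /-- `Y(a, x) 𝟏` has no negative powers of `x`. -/
  creation_regular : ∀ (a : V) (n : ℤ), 0 ≤ n → VOA.mode Y a n vacuum = 0
  /-- The constant term of `Y(a, x) 𝟏` is `a`. -/
  creation : ∀ a : V, VOA.mode Y a (-1) vacuum = a
  jacobi : VOA.JacobiIdentity Y Y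
  /-- The operators `L(n) = ω_{n+1}` satisfy the Virasoro relations. -/
  virasoro : VOA.VirasoroRelations (fun n => VOA.mode Y conformal (n + 1)) rank
  /-- `L(0) a = n a` for `a ∈ V_(n)`. -/
  L_zero : ∀ (n : ℤ), ∀ a ∈ grading n, VOA.mode Y conformal 1 a = (n : ℂ) • a
  /-- `Y(L(-1) a, x) = d/dx Y(a, x)`. -/
  L_neg_one : ∀ (a : V) (n : ℤ),
    VOA.mode Y (VOA.mode Y conformal 0 a) n = (-(n : ℂ)) • VOA.mode Y a (n - 1)

/-- A module `(W, Y)` for a vertex operator algebra: it is `ℂ`-graded by the eigenvalues of `L(0)`,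
with finite-dimensional homogeneous subspaces, which vanish when the real part of the weight is
sufficiently small, and it satisfies all the axioms of an algebra that make sense. -/
structure VOAModule {V : Type u} [AddCommGroup V] [Module ℂ V] (A : VertexOperatorAlgebra V)
    (W : Type w) [AddCommGroup W] [Module ℂ W] where
  /-- The homogeneous subspaces `W_(n)`, `n ∈ ℂ`. -/
  grading : ℂ → Submodule ℂ W
  isInternal : DirectSum.IsInternal grading
  finiteDimensional : ∀ n, FiniteDimensional ℂ (grading n)
  lower_truncated : ∃ N : ℝ, ∀ n : ℂ, n.re < N → grading n = ⊥
  /-- The vertex operator map `a ↦ Y(a, x)`. -/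
  Y : V →ₗ[ℂ] VertexOperator ℂ W
  /-- `Y(𝟏, x) = 1`. -/
  vacuum_left : ∀ (n : ℤ) (x : W), VOA.mode Y A.vacuum n x = if n = -1 then x else 0
  jacobi : VOA.JacobiIdentity A.Y Y
  /-- The operators `L(n) = ω_{n+1}` satisfy the Virasoro relations. -/
  virasoro : VOA.VirasoroRelations (fun n => VOA.mode Y A.conformal (n + 1)) A.rank
  /-- `L(0) x = n x` for `x ∈ W_(n)`. -/
  L_zero : ∀ (n : ℂ), ∀ x ∈ grading n, VOA.mode Y A.conformal 1 x = n • x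
  /-- `Y(L(-1) a, x) = d/dx Y(a, x)`. -/
  L_neg_one : ∀ (a : V) (n : ℤ),
    VOA.mode Y (VOA.mode A.Y A.conformal 0 a) n = (-(n : ℂ)) • VOA.mode Y a (n - 1)

namespace VOAModule

variable {V : Type u} [AddCommGroup V] [Module ℂ V] {A : VertexOperatorAlgebra V}

section single

variable {W : Type w} [AddCommGroup W] [Module ℂ W] (M : VOAModule A W)

/-- The projection of `W` onto its homogeneous subspace of weight `n`. -/
def proj (n : ℂ) : W →ₗ[ℂ] M.grading n :=
  letI : DirectSum.Decomposition M.grading := M.isInternal.chooseDecomposition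
  DirectSum.component ℂ ℂ (fun k : ℂ => M.grading k) n ∘ₗ
    (DirectSum.decomposeLinearEquiv M.grading : W →ₗ[ℂ] DirectSum ℂ (fun k : ℂ => M.grading k))

/-- The formal completion `W̄ = ∏_{n ∈ ℂ} W_(n)`. For `f ∈ W̄`, the vector `f n` is the component
of `f` of weight `n`, i.e. `P_n(f)`. -/
abbrev Completion : Type w := ∀ n : ℂ, M.grading n

/-- The graded dual `W' = ∐_{n ∈ ℂ} W_(n)^*`. -/
abbrev GradedDual : Type w := DirectSum ℂ (fun n => Module.Dual ℂ (M.grading n))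

/-- The natural pairing between `W'` and `W̄`, `⟨w', f⟩ = ∑ₙ w'ₙ(fₙ)` (a finite sum). -/
def pairing : M.GradedDual →ₗ[ℂ] Module.Dual ℂ M.Completion :=
  DirectSum.toModule ℂ ℂ (Module.Dual ℂ M.Completion) (fun n =>
    (LinearMap.proj n : M.Completion →ₗ[ℂ] M.grading n).dualMap)

/-- The action of the operator `aₙ` on the completion `W̄`: the component of weight `N` of `aₙ f` is
`∑_K P_N (aₙ f_K)`. Only finitely many terms are nonzero, since `aₙ` is a finite sum of operators
that shift weights by an integer. -/
def modeCompletion (a : V) (n : ℤ) (f : M.Completion) : M.Completion :=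
  fun N => ∑ᶠ K : ℂ, M.proj N (VOA.mode M.Y a n (f K : W))

end single

variable {W₁ W₂ W₃ W₄ W₅ : Type w}
  [AddCommGroup W₁] [Module ℂ W₁] [AddCommGroup W₂] [Module ℂ W₂]
  [AddCommGroup W₃] [Module ℂ W₃] [AddCommGroup W₄] [Module ℂ W₄]
  [AddCommGroup W₅] [Module ℂ W₅]

/-- `F : W₁ ⊗ W₂ → W̄₃` is a `P(z)`-intertwining map of type `W₃ / (W₁ W₂)` (for a nonzero complex
number `z`):
`x₀⁻¹ δ((x₁ - z)/x₀) Y₃(a, x₁) F(w₁ ⊗ w₂)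
  = z⁻¹ δ((x₁ - x₀)/z) F(Y₁(a, x₀) w₁ ⊗ w₂) + x₀⁻¹ δ((z - x₁)/(-x₀)) F(w₁ ⊗ Y₂(a, x₁) w₂)`.
Stated here is the equality of the coefficients of `x₀^(-l-1) x₁^(-m-1)`, in each weight `N`, for
all integers `l`, `m`. Only finitely many terms of each sum are nonzero: on the left because the
weights of `W₃` are truncated below, on the right because `aₙ w = 0` for `n` large. -/
def IsIntertwiningMap (z : ℂ) (M₁ : VOAModule A W₁) (M₂ : VOAModule A W₂)
    (M₃ : VOAModule A W₃) (F : W₁ ⊗[ℂ] W₂ →ₗ[ℂ] M₃.Completion) : Prop :=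
  ∀ (a : V) (w₁ : W₁) (w₂ : W₂) (l m : ℤ) (N : ℂ),
    ∑ᶠ i : ℕ, ((Ring.choose l i : ℤ) * (-z) ^ i) •
        M₃.modeCompletion a (m + l - i) (F (w₁ ⊗ₜ w₂)) N
      = ∑ᶠ i : ℕ, ((Ring.choose m i : ℤ) * z ^ (m - i)) •
          F ((VOA.mode M₁.Y a (l + i) w₁) ⊗ₜ w₂) N
        + ∑ᶠ i : ℕ, ((-1) ^ (l + i) * (Ring.choose l i : ℤ) * z ^ (l - i)) •
          F (w₁ ⊗ₜ (VOA.mode M₂.Y a (m + i) w₂)) N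

/-- The product of `F₁ : W₁ ⊗ W₅ → W̄₄` and `F₂ : W₂ ⊗ W₃ → W̄₅` exists: the series
`∑_{n ∈ ℂ} ⟨w₄', F₁(w₁ ⊗ P_n(F₂(w₂ ⊗ w₃)))⟩` is always absolutely convergent. -/
def ProductExists (M₄ : VOAModule A W₄) (M₅ : VOAModule A W₅)
    (F₁ : W₁ ⊗[ℂ] W₅ →ₗ[ℂ] M₄.Completion) (F₂ : W₂ ⊗[ℂ] W₃ →ₗ[ℂ] M₅.Completion) : Prop :=
  ∀ (w₁ : W₁) (w₂ : W₂) (w₃ : W₃) (w₄' : M₄.GradedDual),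
    Summable fun n : ℂ => ‖M₄.pairing w₄' (F₁ (w₁ ⊗ₜ (F₂ (w₂ ⊗ₜ w₃) n : W₅)))‖

/-- The iterate of `F₃ : W₁ ⊗ W₂ → W̄₅` and `F₄ : W₅ ⊗ W₃ → W̄₄` exists: the series
`∑_{n ∈ ℂ} ⟨w₄', F₄(P_n(F₃(w₁ ⊗ w₂)) ⊗ w₃)⟩` is always absolutely convergent. -/
def IterateExists (M₄ : VOAModule A W₄) (M₅ : VOAModule A W₅)
    (F₃ : W₁ ⊗[ℂ] W₂ →ₗ[ℂ] M₅.Completion) (F₄ : W₅ ⊗[ℂ] W₃ →ₗ[ℂ] M₄.Completion) : Prop :=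
  ∀ (w₁ : W₁) (w₂ : W₂) (w₃ : W₃) (w₄' : M₄.GradedDual),
    Summable fun n : ℂ => ‖M₄.pairing w₄' (F₄ ((F₃ (w₁ ⊗ₜ w₂) n : W₅) ⊗ₜ w₃))‖

end VOAModule

end

/-! Skew-symmetry exchanges products and iterates. If `F` is a P(z)-intertwining map, then `w₂ ⊗ w₁
↦ exp(-z L(-1)) F(w₁ ⊗ w₂)` is a P(-z)-intertwining map with the two inputs swapped
(`IsIntertwiningMap.skew`), and `F` is recovered by applying `exp(z L(-1))`. Replacing the outer map
by its skew turns an iterate into a product and conversely. The remaining exponential passes to the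
graded dual (`exists_pairing_expLneg`), so the two series agree term by term; the condition on
absolute values survives since |-z| = |z|.

That the skew map is intertwining comes from the conjugation `exp(z L(-1)) Y(a, x) exp(-z L(-1)) =
Y(a, x + z)` on the completion (`expLneg_modeSum`). In coefficients this follows from `[L(-1), aₙ] =
-n aₙ₋₁` and Chu-Vandermonde. Lower truncation makes every sum finite in each weight. -/

noncomputable section

/-! ### Binomial identities over the integers. -/

open Finset in
theorem Int.choose_cast_mul_succ (p : ℤ) (j : ℕ) :
    ((Ring.choose p (j + 1) : ℤ) : ℂ) * (j + 1) = p * (Ring.choose (p - 1) j : ℤ) := by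
  have h := Ring.choose_smul_choose p (n := j + 1) (k := 1) (by omega)
  simp at h
  have h2 : ((j + 1 : ℤ)) * Ring.choose p (j + 1) = p * Ring.choose (p - 1) j := by
    simpa using h
  rw [mul_comm]
  exact_mod_cast congrArg (Int.cast : ℤ → ℂ) h2

open Finset in
/-- A form of the Chu-Vandermonde identity. -/
theorem Int.sum_antidiagonal_choose_mul_neg_one_pow_choose (l m : ℤ) (t : ℕ) :
    ∑ q ∈ antidiagonal t, (Ring.choose l q.1 * ((-1) ^ q.2 * Ring.choose (m + l - q.1) q.2) : ℤ)
      = (-1) ^ t * Ring.choose m t := by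
  -- Upper negation makes the upper entry of the second binomial `t - 1 - m - l`, the same for all
  -- `q`; the sum is then a Vandermonde convolution.
  have key (p : ℤ) (j : ℕ) : (-1) ^ j * Ring.choose p j = Ring.choose (j - 1 - p) j := by
    have := Ring.choose_neg (p - j + 1) j
    rw [show -(p - j + 1) = j - 1 - p by ring, show p - j + 1 + j - 1 = p by ring] at this
    rw [this]
    simp [Int.negOnePow_def, Units.smul_def]
  rw [key, show (t : ℤ) - 1 - m = l + (t - 1 - m - l) by ring,
    Ring.add_choose_eq t (Commute.all _ _)]
  refine sum_congr rfl fun q hq => ?_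
  rw [key, ← mem_antidiagonal.1 hq]
  congr 2
  push_cast
  ring

theorem Finset.sum_antidiagonal_antidiagonal_assoc {M : Type*} [AddCommMonoid M] (t : ℕ)
    (f : ℕ → ℕ → ℕ → M) :
    ∑ q ∈ antidiagonal t, ∑ r ∈ antidiagonal q.2, f q.1 r.1 r.2 =
      ∑ q ∈ antidiagonal t, ∑ r ∈ antidiagonal q.1, f r.1 r.2 q.2 := by
  rw [sum_sigma', sum_sigma']
  refine sum_nbij' (fun x => ⟨(x.1.1 + x.2.1, x.2.2), (x.1.1, x.2.1)⟩)
    (fun x => ⟨(x.2.1, x.2.2 + x.1.2), (x.2.2, x.1.2)⟩) ?_ ?_ ?_ ?_ ?_ <;>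
    rintro ⟨⟨i, j⟩, ⟨k, n⟩⟩ hx <;> simp at hx ⊢ <;> grind

/-! ### Divided powers of a derivation-like operator. -/

namespace VOA

section DividedPower

variable {R : Type*} [Ring R] [Algebra ℂ R]

/-- The divided power `Lᵏ / k!`. -/
def dividedPow (L : R) (k : ℕ) : R := ((k.factorial : ℂ)⁻¹) • L ^ k

theorem dividedPow_zero (L : R) : dividedPow L 0 = 1 := by simp [dividedPow]

theorem succ_smul_dividedPow_succ (L : R) (k : ℕ) :
    ((k : ℂ) + 1) • dividedPow L (k + 1) = dividedPow L k * L := by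
  have h : (k : ℂ) + 1 ≠ 0 := by exact_mod_cast Nat.succ_ne_zero k
  rw [dividedPow, dividedPow, smul_smul, smul_mul_assoc, ← pow_succ, Nat.factorial_succ]
  congr 1
  push_cast
  field_simp

open Finset in
theorem sum_antidiagonal_dividedPow_mul (L : R) (y z : ℂ) (t : ℕ) :
    ∑ q ∈ antidiagonal t, (y ^ q.1 * z ^ q.2) • (dividedPow L q.1 * dividedPow L q.2)
      = (y + z) ^ t • dividedPow L t := by
  rw [(Commute.all y z).add_pow', sum_smul]
  refine sum_congr rfl fun q hq => ?_
  have hq := mem_antidiagonal.1 hq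
  simp only [dividedPow, smul_mul_smul_comm, ← pow_add, hq, smul_smul]
  congr 1
  have h := Nat.choose_mul_factorial_mul_factorial (show q.1 ≤ t by omega)
  rw [show t - q.1 = q.2 by omega] at h
  have h' : ((t.choose q.1 : ℂ)) * q.1.factorial * q.2.factorial = t.factorial := by
    exact_mod_cast h
  have h1 : (q.1.factorial : ℂ) ≠ 0 := by exact_mod_cast q.1.factorial_ne_zero
  have h2 : (q.2.factorial : ℂ) ≠ 0 := by exact_mod_cast q.2.factorial_ne_zero
  have h3 : (t.factorial : ℂ) ≠ 0 := by exact_mod_cast t.factorial_ne_zero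
  rw [nsmul_eq_mul]
  field_simp
  linear_combination y ^ q.1 * z ^ q.2 * (-h')

variable {L : R} {a : ℤ → R}

open Finset in
theorem dividedPow_mul (h : ∀ p : ℤ, L * a p = a p * L - (p : ℂ) • a (p - 1)) (k : ℕ) :
    ∀ p : ℤ, dividedPow L k * a p =
      ∑ q ∈ antidiagonal k, ((-1 : ℂ) ^ q.1 * (Ring.choose p q.1 : ℤ)) •
        (a (p - q.1) * dividedPow L q.2) := by
  induction k with
  | zero => intro p; simp [dividedPow_zero]
  | succ k ih =>
    intro p
    have hk : (k : ℂ) + 1 ≠ 0 := by exact_mod_cast Nat.succ_ne_zero k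
    rw [← smul_right_inj hk (M := R), ← smul_mul_assoc, succ_smul_dividedPow_succ, mul_assoc, h,
      mul_sub, ← mul_assoc, mul_smul_comm, ih, ih, smul_sum, smul_sum]
    -- Split `k + 1 = q.2 + q.1`: the `q.2` part lowers the divided power and gives the terms ending
    -- in `L`, the `q.1` part lowers the binomial and gives the terms in `a (p - 1)`.
    have e : ∀ q ∈ antidiagonal (k + 1), ((k : ℂ) + 1) •
        (((-1 : ℂ) ^ q.1 * (Ring.choose p q.1 : ℤ)) • (a (p - q.1) * dividedPow L q.2)) =
        (q.2 : ℂ) • (((-1 : ℂ) ^ q.1 * (Ring.choose p q.1 : ℤ)) •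
          (a (p - q.1) * dividedPow L q.2)) +
        (q.1 : ℂ) • (((-1 : ℂ) ^ q.1 * (Ring.choose p q.1 : ℤ)) •
          (a (p - q.1) * dividedPow L q.2)) := by
      intro q hq
      rw [← add_smul]
      congr 1
      have := mem_antidiagonal.1 hq
      rw [add_comm (q.2 : ℂ)]
      exact_mod_cast this.symm
    rw [sum_congr rfl e, sum_add_distrib, Nat.sum_antidiagonal_succ', Nat.sum_antidiagonal_succ,
      sub_eq_add_neg, sum_mul, ← sum_neg_distrib]
    simp only [Nat.cast_zero, zero_smul, zero_add]
    congr 1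
    · refine sum_congr rfl fun q _ => ?_
      rw [smul_mul_assoc, mul_assoc, ← succ_smul_dividedPow_succ, mul_smul_comm, smul_comm]
      push_cast
      rfl
    · refine sum_congr rfl fun q _ => ?_
      rw [smul_smul, smul_smul, ← neg_smul]
      have e2 : p - 1 - (q.1 : ℤ) = p - ((q.1 + 1 : ℕ) : ℤ) := by push_cast; ring
      rw [e2]
      congr 1
      have := Int.choose_cast_mul_succ p q.1
      rw [pow_succ]
      push_cast
      linear_combination (-1 : ℂ) ^ q.1 * this

open Finset in
/-- Conjugation by `exp(zL)` shifts the variable of `∑ₚ aₚ x^(-p-1)` by `z`, in coefficients. -/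
theorem sum_antidiagonal_dividedPow_mul_mode
    (h : ∀ p : ℤ, L * a p = a p * L - (p : ℂ) • a (p - 1)) (l m : ℤ) (t : ℕ) :
    ∑ q ∈ antidiagonal t, ((Ring.choose l q.1 : ℤ) : ℂ) • (dividedPow L q.2 * a (m + l - q.1)) =
      ∑ q ∈ antidiagonal t, ((-1 : ℂ) ^ q.1 * (Ring.choose m q.1 : ℤ)) •
        (a (m + l - q.1) * dividedPow L q.2) := by
  simp only [dividedPow_mul h, smul_sum, smul_smul]
  rw [sum_antidiagonal_antidiagonal_assoc t fun i j k =>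
    (((Ring.choose l i : ℤ) : ℂ) * ((-1 : ℂ) ^ j * (Ring.choose (m + l - i) j : ℤ))) •
      (a (m + l - i - j) * dividedPow L k)]
  refine sum_congr rfl fun q _ => ?_
  -- For a fixed power of `L` on the right, the inner sum of coefficients is the Chu-Vandermonde
  -- sum.
  have := congrArg (Int.cast : ℤ → ℂ)
    (Int.sum_antidiagonal_choose_mul_neg_one_pow_choose l m q.1)
  push_cast at this
  rw [← this, sum_smul]
  refine sum_congr rfl fun r hr => ?_
  rw [← mem_antidiagonal.1 hr]
  push_cast
  rw [sub_sub]

end DividedPower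

end VOA

/-! ### Modes and the commutator formula. -/

namespace VOA

variable {V : Type*} [AddCommGroup V] [Module ℂ V] {W : Type*} [AddCommGroup W] [Module ℂ W]

theorem exists_forall_ge_mode_eq_zero (Y : V →ₗ[ℂ] VertexOperator ℂ W) (a : V) (x : W) :
    ∃ n₀ : ℤ, ∀ n ≥ n₀, mode Y a n x = 0 :=
  ⟨-HahnSeries.order ((HahnModule.of ℂ).symm (Y a x)), fun n hn =>
    VertexOperator.ncoeff_eq_zero_of_lt_order _ _ _ (by omega)⟩

theorem exists_forall_ge_mode_add_eq_zero (Y : V →ₗ[ℂ] VertexOperator ℂ W) (a : V) (x : W)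
    (l : ℤ) : ∃ n₀ : ℕ, ∀ i ≥ n₀, mode Y a (l + (i : ℕ)) x = 0 := by
  obtain ⟨n₀, h⟩ := exists_forall_ge_mode_eq_zero Y a x
  exact ⟨(n₀ - l).toNat, fun i hi => h _ (by omega)⟩

theorem mode_add (Y : V →ₗ[ℂ] VertexOperator ℂ W) (a b : V) (n : ℤ) :
    mode Y (a + b) n = mode Y a n + mode Y b n := by simp [mode]

theorem mode_zero (Y : V →ₗ[ℂ] VertexOperator ℂ W) (n : ℤ) : mode Y 0 n = 0 := by simp [mode]

theorem mode_smul (Y : V →ₗ[ℂ] VertexOperator ℂ W) (c : ℂ) (a : V) (n : ℤ) :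
    mode Y (c • a) n = c • mode Y a n := by simp [mode]

/-- The commutator formula. -/
theorem JacobiIdentity.commutator {Y : V →ₗ[ℂ] VertexOperator ℂ V}
    {YW : V →ₗ[ℂ] VertexOperator ℂ W} (h : JacobiIdentity Y YW) (a b : V) (x : W) (m n : ℤ) :
    mode YW a m (mode YW b n x) - mode YW b n (mode YW a m x) =
      ∑ᶠ i : ℕ, ((Ring.choose m i : ℤ) : ℂ) • mode YW (mode Y a i b) (m + n - i) x := by
  have := h a b x 0 m n
  rw [finsum_eq_single _ 0 (fun i hi => by simp [Ring.choose_zero_pos ℤ (Nat.pos_of_ne_zero hi)]),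
    finsum_eq_single _ 0 (fun i hi => by simp [Ring.choose_zero_pos ℤ (Nat.pos_of_ne_zero hi)])]
    at this
  simpa using this

end VOA

/-! ### Weights and `L(-1)` in a module. -/

namespace VOAModule

open VOA

variable {V : Type u} [AddCommGroup V] [Module ℂ V] {A : VertexOperatorAlgebra V}
  {W : Type w} [AddCommGroup W] [Module ℂ W] (M : VOAModule A W)

/-- The operator `L(-1)`. -/
abbrev Lneg : Module.End ℂ W := mode M.Y A.conformal 0

theorem proj_of_mem {n : ℂ} {x : W} (hx : x ∈ M.grading n) : M.proj n x = ⟨x, hx⟩ := by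
  let _ : DirectSum.Decomposition M.grading := M.isInternal.chooseDecomposition
  exact Subtype.ext (DirectSum.decompose_of_mem_same M.grading hx)

theorem proj_of_mem_ne {n k : ℂ} {x : W} (hx : x ∈ M.grading k) (h : k ≠ n) :
    M.proj n x = 0 := by
  let _ : DirectSum.Decomposition M.grading := M.isInternal.chooseDecomposition
  exact Subtype.ext (DirectSum.decompose_of_mem_ne M.grading hx h)

theorem eq_zero_of_forall_proj {x : W} (h : ∀ n, M.proj n x = 0) : x = 0 := by
  let _ : DirectSum.Decomposition M.grading := M.isInternal.chooseDecomposition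
  apply (DirectSum.decompose M.grading).injective
  rw [DirectSum.decompose_zero]
  exact DFinsupp.ext h

theorem proj_L_zero (n : ℂ) (x : W) :
    M.proj n (mode M.Y A.conformal 1 x) = n • M.proj n x := by
  let _ : DirectSum.Decomposition M.grading := M.isInternal.chooseDecomposition
  induction x using DirectSum.Decomposition.inductionOn M.grading with
  | zero => simp
  | homogeneous y =>
    rename_i k
    rw [M.L_zero k y y.2, map_smul]
    by_cases h : k = n
    · subst h
      rfl
    · rw [M.proj_of_mem_ne y.2 h, smul_zero, smul_zero]
  | add x y hx hy => rw [map_add, map_add, hx, hy, map_add, smul_add]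

/-- A component of an eigenvector in a weight `k ≠ n` is killed by `n - k`. Weights can therefore be
computed from commutators with `L(0)`. -/
theorem mem_grading_iff {n : ℂ} {x : W} :
    x ∈ M.grading n ↔ mode M.Y A.conformal 1 x = n • x := by
  refine ⟨M.L_zero n x, fun h => ?_⟩
  have : x - M.proj n x = 0 := M.eq_zero_of_forall_proj fun k => by
    rw [map_sub]
    by_cases hk : n = k
    · subst hk
      rw [M.proj_of_mem (M.proj n x).2, sub_self]
    · rw [M.proj_of_mem_ne (M.proj n x).2 hk, sub_zero]
      have h1 := M.proj_L_zero k x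
      rw [h, map_smul, ← sub_eq_zero, ← sub_smul] at h1
      exact (smul_eq_zero.1 h1).resolve_left (sub_ne_zero.2 hk)
  rw [sub_eq_zero.1 this]
  exact (M.proj n x).2

theorem Lneg_mul_mode (a : V) (n : ℤ) :
    M.Lneg * mode M.Y a n = mode M.Y a n * M.Lneg - (n : ℂ) • mode M.Y a (n - 1) := by
  ext x
  have := M.jacobi.commutator A.conformal a x 0 n
  rw [finsum_eq_single _ 0
    (fun i hi => by simp [Ring.choose_zero_pos ℤ (Nat.pos_of_ne_zero hi)])] at this
  simp only [Ring.choose_zero_right, Int.cast_one, one_smul, Nat.cast_zero, zero_add, sub_zero,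
    M.L_neg_one] at this
  simp only [Module.End.mul_apply, LinearMap.sub_apply, LinearMap.smul_apply]
  rw [sub_eq_iff_eq_add.1 this, LinearMap.smul_apply, neg_smul]
  abel

/-- In the commutator of `L(0) = ω₁` with `aₙ` only `i = 0, 1` survive: `(L(-1)a)ₙ₊₁ = -(n+1) aₙ`
and `(L(0)a)ₙ = s aₙ`. -/
theorem mode_mem {s : ℤ} {a : V} (ha : a ∈ A.grading s) (n : ℤ) {h : ℂ} {x : W}
    (hx : x ∈ M.grading h) : mode M.Y a n x ∈ M.grading (h + s - n - 1) := by
  rw [mem_grading_iff]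
  have := M.jacobi.commutator A.conformal a x 1 n
  rw [finsum_eq_sum_of_support_subset (s := Finset.range 2) _ (by
    intro i hi
    by_contra hc
    have h2 : 2 ≤ i := not_lt.1 fun h => hc (by simpa using h)
    have : Ring.choose (1 : ℤ) i = 0 := by
      have := Ring.choose_natCast (R := ℤ) 1 i
      rw [Nat.choose_eq_zero_of_lt h2] at this
      simpa using this
    simp [this] at hi), Finset.sum_range_succ, Finset.sum_range_one] at this
  simp only [Ring.choose_zero_right, Ring.choose_one_right, Int.cast_one, one_smul, Nat.cast_zero,
    Nat.cast_one, sub_zero, M.L_neg_one, A.L_zero s a ha, mode_smul, M.L_zero h x hx, map_smul,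
    LinearMap.smul_apply] at this
  rw [sub_eq_iff_eq_add.1 this]
  simp only [add_sub_cancel_left, ← add_smul]
  congr 1
  push_cast
  ring

theorem Lneg_mem {h : ℂ} {x : W} (hx : x ∈ M.grading h) : M.Lneg x ∈ M.grading (h + 1) := by
  have := M.mode_mem A.conformal_mem 0 hx
  convert this using 2
  push_cast
  ring

theorem dividedPow_Lneg_mem (k : ℕ) {h : ℂ} {x : W} (hx : x ∈ M.grading h) :
    dividedPow M.Lneg k x ∈ M.grading (h + k) := by
  refine Submodule.smul_mem _ _ ?_
  induction k with
  | zero => simpa using hx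
  | succ k ih =>
    rw [pow_succ', Module.End.mul_apply]
    convert M.Lneg_mem ih using 2
    push_cast
    ring

theorem modeCompletion_of_mem {s : ℤ} {a : V} (ha : a ∈ A.grading s) (n : ℤ) (f : M.Completion)
    (N : ℂ) : (M.modeCompletion a n f N : W) = mode M.Y a n (f (N - s + n + 1)) := by
  have hm := M.mode_mem ha n (f (N - s + n + 1)).2
  rw [show N - s + n + 1 + s - n - 1 = N by ring] at hm
  rw [modeCompletion, finsum_eq_single _ (N - s + n + 1), M.proj_of_mem hm]
  intro K hK
  refine M.proj_of_mem_ne (M.mode_mem ha n (f K).2) fun h => hK ?_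
  rw [← h]
  ring

/-- The homogeneous subspaces of weight `c - i` vanish for `i` large. -/
theorem exists_forall_ge_grading_eq_bot (c : ℂ) :
    ∃ n₀ : ℕ, ∀ i ≥ n₀, M.grading (c - (i : ℕ)) = ⊥ := by
  obtain ⟨B, hB⟩ := M.lower_truncated
  obtain ⟨n₀, h⟩ := exists_nat_gt (c.re - B)
  refine ⟨n₀, fun i hi => hB _ ?_⟩
  have : (n₀ : ℝ) ≤ i := by exact_mod_cast hi
  simp only [Complex.sub_re, Complex.natCast_re]
  linarith

end VOAModule

/-! ### The exponential of `L(-1)` on the completion. -/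

open Finset in
theorem Finset.sum_range_sum_range_sub {M : Type*} [AddCommMonoid M] (n : ℕ) (g : ℕ → ℕ → M) :
    ∑ k ∈ range n, ∑ i ∈ range (n - k), g k i =
      ∑ t ∈ range n, ∑ q ∈ antidiagonal t, g q.1 q.2 := by
  rw [← sum_range_diag_flip]
  exact sum_congr rfl fun t _ => (Nat.sum_antidiagonal_eq_sum_range_succ g t).symm

namespace VOAModule

open VOA

variable {V : Type u} [AddCommGroup V] [Module ℂ V] {A : VertexOperatorAlgebra V}

section single

variable {W : Type w} [AddCommGroup W] [Module ℂ W] (M : VOAModule A W)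

theorem coe_completion_eq_zero (f : M.Completion) {n : ℂ} (h : M.grading n = ⊥) :
    (f n : W) = 0 :=
  (Submodule.mem_bot ℂ).1 (h.le (f n).2)

theorem dividedPow_Lneg_sub_mem (k : ℕ) {N : ℂ} {x : W} (hx : x ∈ M.grading (N - k)) :
    dividedPow M.Lneg k x ∈ M.grading N := by
  simpa using M.dividedPow_Lneg_mem k hx

/-- The operator `exp(z L(-1))` on the completion `W̄`. -/
def expLneg (z : ℂ) : M.Completion →ₗ[ℂ] M.Completion where
  toFun f N := ∑ k ∈ Finset.range (M.exists_forall_ge_grading_eq_bot N).choose,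
    z ^ k • ⟨dividedPow M.Lneg k (f (N - k)), M.dividedPow_Lneg_sub_mem k (f (N - k)).2⟩
  map_add' f g := by
    ext N
    simp [Finset.sum_add_distrib]
  map_smul' c f := by
    ext N
    simp [Finset.smul_sum, smul_comm c]

/-- Terms past any truncation bound vanish, so the bound chosen in the definition is immaterial and
several sums can share one. -/
theorem coe_expLneg (z : ℂ) (f : M.Completion) {N : ℂ} {n : ℕ}
    (hn : ∀ i ≥ n, M.grading (N - (i : ℕ)) = ⊥) :
    (M.expLneg z f N : W) =
      ∑ k ∈ Finset.range n, z ^ k • dividedPow M.Lneg k (f (N - k)) := by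
  have key : ∀ m : ℕ, (∀ i ≥ m, M.grading (N - (i : ℕ)) = ⊥) → ∀ r ≥ m,
      ∑ k ∈ Finset.range m, z ^ k • dividedPow M.Lneg k (f (N - k) : W) =
        ∑ k ∈ Finset.range r, z ^ k • dividedPow M.Lneg k (f (N - k) : W) := by
    intro m hm r hr
    refine Finset.sum_subset (by simpa using hr) fun k _ hk => ?_
    rw [M.coe_completion_eq_zero f (hm k (by simpa using hk)), map_zero, smul_zero]
  have h0 := (M.exists_forall_ge_grading_eq_bot N).choose_spec
  rw [key n hn _ (le_max_right (M.exists_forall_ge_grading_eq_bot N).choose n),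
    ← key _ h0 _ (le_max_left _ _)]
  simp [expLneg]

theorem grading_sub_sub_eq_bot {c : ℂ} {n : ℕ} (hn : ∀ i ≥ n, M.grading (c - (i : ℕ)) = ⊥)
    (k : ℕ) : ∀ i ≥ n - k, M.grading (c - k - (i : ℕ)) = ⊥ := by
  intro i hi
  rw [sub_sub, ← Nat.cast_add]
  exact hn _ (by omega)

theorem coe_completion_congr (f : M.Completion) {n k : ℂ} (h : n = k) : (f n : W) = f k := by
  rw [h]

theorem expLneg_expLneg (y z : ℂ) (f : M.Completion) :
    M.expLneg y (M.expLneg z f) = M.expLneg (y + z) f := by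
  ext N
  obtain ⟨n, hn⟩ := M.exists_forall_ge_grading_eq_bot N
  rw [M.coe_expLneg _ _ hn, M.coe_expLneg _ _ hn]
  have : ∀ k : ℕ, (M.expLneg z f (N - k) : W) = ∑ i ∈ Finset.range (n - k),
      z ^ i • dividedPow M.Lneg i (f (N - k - i)) := fun k =>
    M.coe_expLneg z f (M.grading_sub_sub_eq_bot hn k)
  simp only [this, map_sum, Finset.smul_sum]
  -- Regroup by total degree `t = k + i`; each degree is then the binomial theorem for divided
  -- powers.
  rw [Finset.sum_range_sum_range_sub n fun k i =>
    y ^ k • dividedPow M.Lneg k (z ^ i • dividedPow M.Lneg i (f (N - k - i) : W))]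
  refine Finset.sum_congr rfl fun t _ => ?_
  have := LinearMap.congr_fun (sum_antidiagonal_dividedPow_mul M.Lneg y z t) (f (N - t) : W)
  rw [LinearMap.smul_apply] at this
  rw [← this, LinearMap.sum_apply]
  refine Finset.sum_congr rfl fun q hq => ?_
  rw [map_smul, smul_smul, LinearMap.smul_apply, Module.End.mul_apply,
    M.coe_completion_congr f (k := N - t) (by
      rw [← Finset.HasAntidiagonal.mem_antidiagonal.1 hq]; push_cast; ring)]

theorem expLneg_zero (f : M.Completion) : M.expLneg 0 f = f := by
  ext N
  obtain ⟨n, hn⟩ := M.exists_forall_ge_grading_eq_bot N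
  rw [M.coe_expLneg _ _ (n := n + 1) (fun i hi => hn i (by omega)), Finset.sum_range_succ']
  simpa [dividedPow_zero] using M.coe_completion_congr f (by simp)

/-- The graded dual is stable under the transpose of `exp(z L(-1))`. -/
theorem exists_pairing_expLneg (z : ℂ) (w' : M.GradedDual) :
    ∃ w'' : M.GradedDual, ∀ f, M.pairing w' (M.expLneg z f) = M.pairing w'' f := by
  induction w' using DirectSum.induction_on with
  | zero => exact ⟨0, by simp⟩
  | of N φ =>
    obtain ⟨n, hn⟩ := M.exists_forall_ge_grading_eq_bot N
    -- A functional on weight `N` sees only the finitely many nonzero weights `N - k`, so its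
    -- transpose is a finite sum.
    let T (k : ℕ) : M.grading (N - k) →ₗ[ℂ] M.grading N :=
      (dividedPow M.Lneg k ∘ₗ (M.grading (N - k)).subtype).codRestrict (M.grading N)
        fun x => M.dividedPow_Lneg_sub_mem k x.2
    have hof (K : ℂ) (ψ : Module.Dual ℂ (M.grading K)) (f : M.Completion) :
        M.pairing (DirectSum.of (fun n => Module.Dual ℂ (M.grading n)) K ψ) f = ψ (f K) := by
      rw [pairing, ← DirectSum.lof_eq_of ℂ, DirectSum.toModule_lof]
      rfl
    refine ⟨∑ k ∈ Finset.range n, DirectSum.of _ (N - k) (z ^ k • φ ∘ₗ T k), fun f => ?_⟩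
    have : M.expLneg z f N = ∑ k ∈ Finset.range n, z ^ k • T k (f (N - k)) := by
      ext
      rw [M.coe_expLneg z f hn]
      simp [T]
    rw [hof, this, map_sum, map_sum, LinearMap.sum_apply]
    refine Finset.sum_congr rfl fun k _ => ?_
    rw [hof, map_smul]
    rfl
  | add x y hx hy =>
    obtain ⟨x', hx⟩ := hx
    obtain ⟨y', hy⟩ := hy
    exact ⟨x' + y', fun f => by simp only [map_add, LinearMap.add_apply, hx, hy]⟩

/-! ### Conjugation of vertex operators by the exponential. -/

/-- The coefficient of `x^(-p-1)` in `(1 + z/x)^l Y(a, x) f`. -/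
def modeSum (a : V) (l p : ℤ) (z : ℂ) (f : M.Completion) : M.Completion :=
  fun N => ∑ᶠ i : ℕ, ((Ring.choose l i : ℤ) * z ^ i) • M.modeCompletion a (p - i) f N

theorem coe_modeCompletion_sub {s : ℤ} {a : V} (ha : a ∈ A.grading s) (p : ℤ) (i : ℕ)
    (f : M.Completion) (N : ℂ) :
    (M.modeCompletion a (p - i) f N : W) = mode M.Y a (p - i) (f (N - s + p + 1 - i)) := by
  rw [M.modeCompletion_of_mem ha,
    M.coe_completion_congr f (k := N - s + p + 1 - i) (by push_cast; ring)]

theorem coe_modeSum {s : ℤ} {a : V} (ha : a ∈ A.grading s) (l p : ℤ) (z : ℂ) (f : M.Completion)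
    {N : ℂ} {n : ℕ} (hn : ∀ i ≥ n, M.grading (N - s + p + 1 - (i : ℕ)) = ⊥) :
    (M.modeSum a l p z f N : W) = ∑ i ∈ Finset.range n,
      ((Ring.choose l i : ℤ) * z ^ i) • mode M.Y a (p - i) (f (N - s + p + 1 - i)) := by
  rw [modeSum, finsum_eq_sum_of_support_subset (s := Finset.range n)]
  · simp only [AddSubmonoidClass.coe_finsetSum, Submodule.coe_smul,
      M.coe_modeCompletion_sub ha]
  · refine Function.support_subset_iff'.2 fun i hi => Subtype.ext ?_
    rw [Submodule.coe_smul, M.coe_modeCompletion_sub ha,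
      M.coe_completion_eq_zero f (hn i (by simpa using hi)), map_zero, smul_zero]
    rfl

/-- Finite supports are what make the `finsum`s additive in `a`. The two claims are proved together
because the second, for a sum of vectors, uses the first. -/
theorem finite_support_modes (a : V) (f : M.Completion) (N : ℂ) :
    (∀ n : ℤ, (Function.support fun K : ℂ => M.proj N (mode M.Y a n (f K : W))).Finite) ∧
      ∀ p : ℤ, (Function.support fun i : ℕ => M.modeCompletion a (p - i) f N).Finite := by
  let _ : DirectSum.Decomposition A.grading := A.isInternal.chooseDecomposition
  induction a using DirectSum.Decomposition.inductionOn A.grading with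
  | zero => simp [mode_zero, modeCompletion]
  | homogeneous a =>
    rename_i s
    constructor
    · intro n
      refine (Set.finite_singleton (N - s + n + 1)).subset
        (Function.support_subset_iff'.2 fun K hK => ?_)
      refine M.proj_of_mem_ne (M.mode_mem a.2 n (f K).2) fun h => hK ?_
      rw [Set.mem_singleton_iff, ← h]
      ring
    · intro p
      obtain ⟨n, hn⟩ := M.exists_forall_ge_grading_eq_bot (N - s + p + 1)
      refine (Finset.range n).finite_toSet.subset
        (Function.support_subset_iff'.2 fun i hi => Subtype.ext ?_)
      rw [M.coe_modeCompletion_sub a.2,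
        M.coe_completion_eq_zero f (hn i (by simpa using hi)), map_zero]
      rfl
  | add a b ha hb =>
    constructor
    · intro n
      refine ((ha.1 n).union (hb.1 n)).subset ?_
      simp only [mode_add, LinearMap.add_apply, map_add]
      exact Function.support_add _ _
    · intro p
      refine ((ha.2 p).union (hb.2 p)).subset ?_
      refine (Eq.subset ?_).trans (Function.support_add _ _)
      congr 1
      ext i : 1
      simp only [modeCompletion, mode_add, LinearMap.add_apply, map_add]
      exact finsum_add_distrib (ha.1 _) (hb.1 _)

theorem modeSum_add (a b : V) (l p : ℤ) (z : ℂ) (f : M.Completion) :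
    M.modeSum (a + b) l p z f = M.modeSum a l p z f + M.modeSum b l p z f := by
  funext N
  have h (n : ℤ) : M.modeCompletion (a + b) n f N =
      M.modeCompletion a n f N + M.modeCompletion b n f N := by
    simp only [modeCompletion, mode_add, LinearMap.add_apply, map_add]
    exact finsum_add_distrib ((M.finite_support_modes a f N).1 n)
      ((M.finite_support_modes b f N).1 n)
  simp only [modeSum, Pi.add_apply, h, smul_add]
  exact finsum_add_distrib
    (((M.finite_support_modes a f N).2 p).subset
      (Function.support_smul_subset_right (fun i : ℕ => ((Ring.choose l i : ℤ) : ℂ) * z ^ i) _))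
    (((M.finite_support_modes b f N).2 p).subset
      (Function.support_smul_subset_right (fun i : ℕ => ((Ring.choose l i : ℤ) : ℂ) * z ^ i) _))

/-- Conjugation by `exp(z L(-1))` shifts the variable of a vertex operator by `z`. -/
theorem expLneg_modeSum (a : V) (l m : ℤ) (z : ℂ) (f : M.Completion) :
    M.expLneg z (M.modeSum a l (m + l) z f) = M.modeSum a m (m + l) (-z) (M.expLneg z f) := by
  -- Formally, both sides are the residue of `x^m (x+z)^l Y(a, x+z) exp(z L(-1)) f`; on the right
  -- the variable is `y = x + z`. Additivity reduces to homogeneous `a`.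
  let _ : DirectSum.Decomposition A.grading := A.isInternal.chooseDecomposition
  induction a using DirectSum.Decomposition.inductionOn A.grading with
  | zero =>
    have (l p : ℤ) (z : ℂ) (f : M.Completion) : M.modeSum 0 l p z f = 0 := by
      funext N
      simp [modeSum, modeCompletion, mode_zero]
    rw [this, this, map_zero]
  | add a b ha hb => rw [modeSum_add, modeSum_add, map_add, ha, hb]
  | homogeneous a =>
    rename_i s
    ext N
    obtain ⟨n₁, hn₁⟩ := M.exists_forall_ge_grading_eq_bot N
    obtain ⟨n₂, hn₂⟩ := M.exists_forall_ge_grading_eq_bot (N - s + (m + l : ℤ) + 1)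
    -- The weight that `a_(m+l)` carries to `N`.
    set c : ℂ := N - s + (m + l : ℤ) + 1 with hc
    set n := max n₁ n₂
    have hN : ∀ i ≥ n, M.grading (N - (i : ℕ)) = ⊥ :=
      fun i hi => hn₁ i (le_trans (le_max_left _ _) hi)
    have hn : ∀ i ≥ n, M.grading (c - (i : ℕ)) = ⊥ :=
      fun i hi => hn₂ i (le_trans (le_max_right _ _) hi)
    rw [M.coe_expLneg _ _ hN, M.coe_modeSum a.2 _ _ _ _ hn]
    have h1 (k : ℕ) : (M.modeSum (a : V) l (m + l) z f (N - k) : W) =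
        ∑ i ∈ Finset.range (n - k), ((Ring.choose l i : ℤ) * z ^ i) •
          mode M.Y a (m + l - i) (f (c - k - i)) := by
      have e : N - k - s + (m + l : ℤ) + 1 = c - k := by rw [hc]; ring
      have := M.coe_modeSum a.2 l (m + l) z f (N := N - k) (n := n - k)
        (by rw [e]; exact M.grading_sub_sub_eq_bot hn k)
      rw [e] at this
      exact this
    have h2 (k : ℕ) : (M.expLneg z f (c - k) : W) = ∑ i ∈ Finset.range (n - k),
        z ^ i • dividedPow M.Lneg i (f (c - k - i)) :=
      M.coe_expLneg z f (M.grading_sub_sub_eq_bot hn k)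
    rw [← hc]
    simp only [h1, h2, map_sum, Finset.smul_sum]
    rw [Finset.sum_range_sum_range_sub n fun k i => z ^ k • dividedPow M.Lneg k
        (((Ring.choose l i : ℤ) * z ^ i) • mode M.Y a (m + l - i) (f (c - k - i) : W)),
      Finset.sum_range_sum_range_sub n fun i k => ((Ring.choose m i : ℤ) * (-z) ^ i) •
        mode M.Y a (m + l - i) (z ^ k • dividedPow M.Lneg k (f (c - i - k) : W))]
    refine Finset.sum_congr rfl fun t _ => ?_
    have key := LinearMap.congr_fun
      (sum_antidiagonal_dividedPow_mul_mode (M.Lneg_mul_mode a) l m t) (z ^ t • (f (c - t) : W))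
    rw [LinearMap.sum_apply, LinearMap.sum_apply] at key
    rw [← Finset.Nat.sum_antidiagonal_swap]
    convert key using 1
    · refine Finset.sum_congr rfl fun q hq => ?_
      have hq := Finset.HasAntidiagonal.mem_antidiagonal.1 hq
      simp only [Prod.fst_swap, Prod.snd_swap, LinearMap.smul_apply, Module.End.mul_apply,
        map_smul, smul_smul]
      rw [M.coe_completion_congr f (k := c - t) (by rw [← hq]; push_cast; ring), ← hq, pow_add]
      congr 1
      ring
    · refine Finset.sum_congr rfl fun q hq => ?_
      have hq := Finset.HasAntidiagonal.mem_antidiagonal.1 hq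
      simp only [LinearMap.smul_apply, Module.End.mul_apply, map_smul, smul_smul]
      rw [M.coe_completion_congr f (k := c - t) (by rw [← hq]; push_cast; ring), ← hq, pow_add,
        neg_pow]
      congr 1
      ring

end single

/-! ### Skew-symmetry of intertwining maps. -/

variable {W₁ W₂ W₃ : Type w}
  [AddCommGroup W₁] [Module ℂ W₁] [AddCommGroup W₂] [Module ℂ W₂]
  [AddCommGroup W₃] [Module ℂ W₃]

/-- The skew-symmetry `w₂ ⊗ w₁ ↦ exp(-z L(-1)) F(w₁ ⊗ w₂)` of a map `F : W₁ ⊗ W₂ → W̄₃`. -/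
def skew (M₃ : VOAModule A W₃) (z : ℂ) (F : W₁ ⊗[ℂ] W₂ →ₗ[ℂ] M₃.Completion) :
    W₂ ⊗[ℂ] W₁ →ₗ[ℂ] M₃.Completion :=
  M₃.expLneg (-z) ∘ₗ F ∘ₗ (TensorProduct.comm ℂ W₂ W₁).toLinearMap

theorem skew_tmul (M₃ : VOAModule A W₃) (z : ℂ) (F : W₁ ⊗[ℂ] W₂ →ₗ[ℂ] M₃.Completion)
    (w₁ : W₁) (w₂ : W₂) : M₃.skew z F (w₂ ⊗ₜ w₁) = M₃.expLneg (-z) (F (w₁ ⊗ₜ w₂)) := rfl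

theorem expLneg_skew_tmul (M₃ : VOAModule A W₃) (z : ℂ) (F : W₁ ⊗[ℂ] W₂ →ₗ[ℂ] M₃.Completion)
    (w₁ : W₁) (w₂ : W₂) : M₃.expLneg z (M₃.skew z F (w₂ ⊗ₜ w₁)) = F (w₁ ⊗ₜ w₂) := by
  rw [skew_tmul, expLneg_expLneg, add_neg_cancel, expLneg_zero]

/-- Conjugation by `exp(-z L(-1))` replaces `x₁` by `x₁ - z`, which is `x₀` in the delta function.
The variables `x₀` and `x₁` thus trade roles, as do the two terms on the right, and `z` becomes
`-z`. -/
theorem IsIntertwiningMap.skew {z : ℂ} {M₁ : VOAModule A W₁} {M₂ : VOAModule A W₂}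
    {M₃ : VOAModule A W₃} {F : W₁ ⊗[ℂ] W₂ →ₗ[ℂ] M₃.Completion}
    (hF : IsIntertwiningMap z M₁ M₂ M₃ F) :
    IsIntertwiningMap (-z) M₂ M₁ M₃ (M₃.skew z F) := by
  intro a w₂ w₁ l m N
  obtain ⟨n₁, h₁⟩ := exists_forall_ge_mode_add_eq_zero M₁.Y a w₁ m
  obtain ⟨n₂, h₂⟩ := exists_forall_ge_mode_add_eq_zero M₂.Y a w₂ l
  have hs (G : W₁ ⊗[ℂ] W₂ →ₗ[ℂ] M₃.Completion) (c : ℕ → ℂ) (N : ℂ) :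
      ∑ᶠ i : ℕ, c i • G (mode M₁.Y a (m + i) w₁ ⊗ₜ w₂) N =
        ∑ i ∈ Finset.range n₁, c i • G (mode M₁.Y a (m + i) w₁ ⊗ₜ w₂) N := by
    refine finsum_eq_sum_of_support_subset _ (Function.support_subset_iff'.2 fun i hi => ?_)
    rw [h₁ i (by simpa using hi), TensorProduct.zero_tmul, map_zero, Pi.zero_apply, smul_zero]
  have ht (G : W₁ ⊗[ℂ] W₂ →ₗ[ℂ] M₃.Completion) (c : ℕ → ℂ) (N : ℂ) :
      ∑ᶠ i : ℕ, c i • G (w₁ ⊗ₜ mode M₂.Y a (l + i) w₂) N =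
        ∑ i ∈ Finset.range n₂, c i • G (w₁ ⊗ₜ mode M₂.Y a (l + i) w₂) N := by
    refine finsum_eq_sum_of_support_subset _ (Function.support_subset_iff'.2 fun i hi => ?_)
    rw [h₂ i (by simpa using hi), TensorProduct.tmul_zero, map_zero, Pi.zero_apply, smul_zero]
  have hsum : M₃.modeSum a m (l + m) (-z) (F (w₁ ⊗ₜ w₂)) =
      ∑ i ∈ Finset.range n₁, ((Ring.choose l i : ℤ) * z ^ (l - i)) •
          F (mode M₁.Y a (m + i) w₁ ⊗ₜ w₂) +
        ∑ i ∈ Finset.range n₂, ((-1) ^ (m + i) * (Ring.choose m i : ℤ) * z ^ (m - i)) •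
          F (w₁ ⊗ₜ mode M₂.Y a (l + i) w₂) := by
    funext N
    -- The exponents `l` and `m` are exchanged, reflecting the swap of `x₀` and `x₁`.
    have := hF a w₁ w₂ m l N
    rw [hs F, ht F] at this
    simp only [Pi.add_apply, Finset.sum_apply, Pi.smul_apply]
    exact this
  have hconj := congrFun (M₃.expLneg_modeSum a m l (-z) (F (w₁ ⊗ₜ w₂))) N
  rw [hsum, neg_neg, add_comm l m] at hconj
  rw [neg_neg]
  refine hconj.symm.trans ?_
  have e1 := hs (M₃.expLneg (-z) ∘ₗ F)
    (fun i => (-1) ^ (l + i) * (Ring.choose l i : ℤ) * (-z) ^ (l - i)) N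
  have e2 := ht (M₃.expLneg (-z) ∘ₗ F) (fun i => (Ring.choose m i : ℤ) * (-z) ^ (m - i)) N
  simp only [skew_tmul]
  simp only [LinearMap.comp_apply] at e1 e2
  rw [e1, e2, map_add, Pi.add_apply, add_comm, map_sum, map_sum, Finset.sum_apply,
    Finset.sum_apply]
  have hpow (p : ℤ) (i : ℕ) : ((-1 : ℂ)) ^ (p + i) = (-1) ^ (p - i) := by
    rw [show p + i = (p - i) + 2 * i by ring, zpow_add₀ (by norm_num), zpow_mul]
    norm_num
  congr 1 <;> refine Finset.sum_congr rfl fun i _ => ?_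
  · rw [map_smul, Pi.smul_apply, hpow, neg_eq_neg_one_mul z, mul_zpow]
    congr 1
    ring
  · rw [map_smul, Pi.smul_apply, hpow, neg_eq_neg_one_mul z, mul_zpow]
    have : ((-1 : ℂ)) ^ (l - i) * (-1) ^ (l - i) = 1 := by
      rw [← mul_zpow]; norm_num
    congr 1
    linear_combination (-((Ring.choose l i : ℤ) : ℂ) * z ^ (l - i)) * this

end VOAModule

end

theorem proposition14p1 {V : Type u} [AddCommGroup V] [Module ℂ V]
    (A : VertexOperatorAlgebra V) :
    (∀ (W₁ W₂ W₃ W₄ W₅ : Type w)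
        [AddCommGroup W₁] [Module ℂ W₁] [AddCommGroup W₂] [Module ℂ W₂]
        [AddCommGroup W₃] [Module ℂ W₃] [AddCommGroup W₄] [Module ℂ W₄]
        [AddCommGroup W₅] [Module ℂ W₅]
        (M₁ : VOAModule A W₁) (M₂ : VOAModule A W₂) (M₃ : VOAModule A W₃)
        (M₄ : VOAModule A W₄) (M₅ : VOAModule A W₅) (z₁ z₂ : ℂ),
        ‖z₂‖ < ‖z₁‖ → 0 < ‖z₂‖ →
        ∀ (F₁ : W₁ ⊗[ℂ] W₅ →ₗ[ℂ] M₄.Completion) (F₂ : W₂ ⊗[ℂ] W₃ →ₗ[ℂ] M₅.Completion),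
          VOAModule.IsIntertwiningMap z₁ M₁ M₅ M₄ F₁ →
          VOAModule.IsIntertwiningMap z₂ M₂ M₃ M₅ F₂ →
          VOAModule.ProductExists M₄ M₅ F₁ F₂)
      ↔
    (∀ (W₁ W₂ W₃ W₄ W₅ : Type w)
        [AddCommGroup W₁] [Module ℂ W₁] [AddCommGroup W₂] [Module ℂ W₂]
        [AddCommGroup W₃] [Module ℂ W₃] [AddCommGroup W₄] [Module ℂ W₄]
        [AddCommGroup W₅] [Module ℂ W₅]
        (M₁ : VOAModule A W₁) (M₂ : VOAModule A W₂) (M₃ : VOAModule A W₃)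
        (M₄ : VOAModule A W₄) (M₅ : VOAModule A W₅) (z₃ z₄ : ℂ),
        ‖z₃‖ < ‖z₄‖ → 0 < ‖z₃‖ →
        ∀ (F₃ : W₁ ⊗[ℂ] W₂ →ₗ[ℂ] M₅.Completion) (F₄ : W₅ ⊗[ℂ] W₃ →ₗ[ℂ] M₄.Completion),
          VOAModule.IsIntertwiningMap z₃ M₁ M₂ M₅ F₃ →
          VOAModule.IsIntertwiningMap z₄ M₅ M₃ M₄ F₄ →
          VOAModule.IterateExists M₄ M₅ F₃ F₄) := by
  constructor
  · intro h W₁ W₂ W₃ W₄ W₅ _ _ _ _ _ _ _ _ _ _ M₁ M₂ M₃ M₄ M₅ z₃ z₄ hlt hpos F₃ F₄ h₃ h₄ w₁ w₂ w₃ w'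
    -- `w''` absorbs the `exp(z₄ L(-1))` that undoes the skew of `F₄`.
    obtain ⟨w'', hw⟩ := M₄.exists_pairing_expLneg z₄ w'
    have := h W₃ W₁ W₂ W₄ W₅ M₃ M₁ M₂ M₄ M₅ (-z₄) z₃ (by rwa [norm_neg]) hpos
      (M₄.skew z₄ F₄) F₃ h₄.skew h₃ w₃ w₁ w₂ w''
    refine this.congr fun n => ?_
    rw [← hw, VOAModule.expLneg_skew_tmul]
  · intro h W₁ W₂ W₃ W₄ W₅ _ _ _ _ _ _ _ _ _ _ M₁ M₂ M₃ M₄ M₅ z₁ z₂ hlt hpos F₁ F₂ h₁ h₂ w₁ w₂ w₃ w'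
    obtain ⟨w'', hw⟩ := M₄.exists_pairing_expLneg z₁ w'
    have := h W₂ W₃ W₁ W₄ W₅ M₂ M₃ M₁ M₄ M₅ z₂ (-z₁) (by rwa [norm_neg]) hpos
      -- `F₂` stays the inner map; only the outer map is skewed.
      F₂ (M₄.skew z₁ F₁) h₂ h₁.skew w₂ w₃ w₁ w''
    refine this.congr fun n => ?_
    rw [← hw, VOAModule.expLneg_skew_tmul]
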